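/- Let $n\ge l\ge 0$ be integers, let $p$ be a real number, and let $\rho=p\,|+\rangle\langle+|+(1-p)\frac{I}{2}$ on $\mathbb C^2$, where $|+\rangle=\frac1{\sqrt2}(|0\rangle+|1\rangle)$ (this is a quantum state when $-1\le p\le 1$). Let $\mathcal H_l^{(n)}\subseteq(\mathbb C^2)^{\otimes n}$ be the span of the standard basis vectors $|x\rangle$, $x\in\{0,1\}^n$, with exactly $l$ ones, let $P_l$ be the orthogonal projector onto $\mathcal H_l^{(n)}$, and let $\rho_l^{(n)}=P_l\,\rho^{\otimes n}P_l$. For $0\le k\le l$ let $A_k^{(l)}=\sum_{x,y:\,d(x,y)=2k}|x\rangle\langle y|$, where $x,y$ range over the bit strings of length $n$ with exactly $l$ ones and $d$ is the Hamming distance. Then there are real numbers $\alpha_k(j)$ ($0\le k\le l$, $0\le j\le\min\{l,n-l\}$) and an orthogonal decomposition $\mathcal H_l^{(n)}=\bigoplus_{j=0}^{\min\{l,n-l\}}B_j$, independent of $p$, such that $$\dim B_j=f_j=\binom nj\frac{n-2j+1}{n-j+1},$$ and such that $A_k^{(l)}$ acts on $B_j$ as the scalar $\alpha_k(j)$, and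 $\rho_l^{(n)}$ acts on $B_j$ as the scalar $$\lambda_l^n(j)=\frac1{2^n}\sum_{k=0}^{l}p^{2k}\alpha_k(j).$$ So the eigenvalues of $\rho_l^{(n)}$ on $\mathcal H_l^{(n)}$ are the $\lambda_l^n(j)$, $j=0,\ldots,\min\{l,n-l\}$, the one indexed by $j$ having multiplicity $f_j$ (multiplicities are added if values for different $j$ coincide); on the whole space $(\mathbb C^2)^{\otimes n}$ the characteristic polynomial of $\rho_l^{(n)}$ is $X^{2^n-\binom nl}\prod_{j}(X-\lambda_l^n(j))^{f_j}$. Moreover, for $0\le k\le l$ and $0\le j\le\min\{l,n-l\}$, $$\alpha_k(j)=\sum_{r=\max\{0,k-j\}}^{\min\{k,l-j\}}(-1)^{k-r}\binom{l-j+k-r}{k}\binom{n-l-k+r}{r}\binom{j}{k-r}$$ $$=\sum_{r=0}^{k}(-1)^{k-r}\binom{l-r}{k-r}\binom{l-j}{r}\binom{n-l-j+r}{r}=(-1)^k\binom lk\;{}_3F_2\!\left(\begin{matrix}-k,\;-l+j,\;n-l-j+1\\-l,\;1\end{matrix};1\right),$$ where an empty sum is $0$ and the hypergeometric series is the terminating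 one, summed over $0\le r\le k$. -/

import Mathlib

noncomputable section

/-- Standard basis labels of `(ℂ²)^{⊗ n}`: the bit strings of length `n`. -/
abbrev Bits (n : ℕ) : Type := Fin n → Fin 2

/-- The Hilbert space `(ℂ²)^{⊗ n}`, in coordinates with respect to the standard basis. -/
abbrev QubitSpace (n : ℕ) : Type := EuclideanSpace ℂ (Bits n)

/-- The vector `|+⟩ = (|0⟩ + |1⟩) / √2`. -/
def ketPlus : Fin 2 → ℂ :=
  ((1 / Real.sqrt 2 : ℝ) : ℂ) • (Pi.single 0 1 + Pi.single 1 1)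

/-- The one-qubit operator `ρ = p |+⟩⟨+| + (1 - p) I / 2`. -/
def rho (p : ℝ) : Matrix (Fin 2) (Fin 2) ℂ :=
  (p : ℂ) • Matrix.vecMulVec ketPlus (star ketPlus)
    + ((1 - p : ℝ) : ℂ) • ((1 / 2 : ℂ) • (1 : Matrix (Fin 2) (Fin 2) ℂ))

/-- The tensor power `M^{⊗ n}`: `⟨x| M^{⊗ n} |y⟩ = ∏ i, ⟨x i| M |y i⟩`. -/
def tensorPow (M : Matrix (Fin 2) (Fin 2) ℂ) (n : ℕ) : Matrix (Bits n) (Bits n) ℂ :=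
  Matrix.of fun x y => ∏ i, M (x i) (y i)

/-- The projector `P_l` onto the span of the standard basis vectors having `l` ones and
`n - l` zeros (`hammingNorm x` is the number of nonzero entries of `x`). -/
def weightProj (n l : ℕ) : Matrix (Bits n) (Bits n) ℂ :=
  Matrix.diagonal fun x => if hammingNorm x = l then 1 else 0

/-- The space `H_l^{(n)}` spanned by the standard basis vectors with `l` ones. -/
def weightSpace (n l : ℕ) : Submodule ℂ (QubitSpace n) :=
  Submodule.span ℂ {v | ∃ x : Bits n, hammingNorm x = l ∧ v = EuclideanSpace.single x 1}

/-- The subnormalized state `ρ_l^{(n)} = P_l ρ^{⊗ n} P_l`. -/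
def rhoL (n l : ℕ) (p : ℝ) : Matrix (Bits n) (Bits n) ℂ :=
  weightProj n l * tensorPow (rho p) n * weightProj n l

/-- The operator `A_k^{(l)} = ∑ |x⟩⟨y|`, the sum over all pairs of bit strings `x, y` with `l` ones
at Hamming distance `2k`; it is extended by zero to the orthogonal complement of `H_l^{(n)}`. -/
def hammingOp (n l k : ℕ) : Matrix (Bits n) (Bits n) ℂ :=
  Matrix.of fun x y =>
    if hammingNorm x = l ∧ hammingNorm y = l ∧ hammingDist x y = 2 * k then 1 else 0

/-- The first closed form. For `j ≤ n - l` and `j ≤ l`, no subtraction of natural numbers here is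
truncated in a way that matters: in the range of summation `r ≤ k`, `r ≤ l - j` and
`k ≤ n - l + r`. -/
def alphaYoung (n l k j : ℕ) : ℝ :=
  ∑ r ∈ Finset.Icc (k - j) (min k (l - j)),
    (-1 : ℝ) ^ (k - r) * ((l - j + k - r).choose k : ℝ) * ((n - l + r - k).choose r : ℝ)
      * (j.choose (k - r) : ℝ)

/-- The second closed form. -/
def alphaScheme (n l k j : ℕ) : ℝ :=
  ∑ r ∈ Finset.range (k + 1),
    (-1 : ℝ) ^ (k - r) * ((l - r).choose (k - r) : ℝ) * ((l - j).choose r : ℝ)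
      * ((n - l - j + r).choose r : ℝ)

/-- The hypergeometric series `₃F₂(a, b, c; d, e; z)`. It is only used with `a = -k` and `d = -l`
for natural numbers `k ≤ l`; there it terminates: the terms with `r > k` are zero (their numerators
vanish), and no denominator vanishes for `r ≤ k`. -/
def hyp32 (a b c d e z : ℝ) : ℝ :=
  ∑' r : ℕ, ((ascPochhammer ℝ r).eval a * (ascPochhammer ℝ r).eval b * (ascPochhammer ℝ r).eval c)
    / ((ascPochhammer ℝ r).eval d * (ascPochhammer ℝ r).eval e) * z ^ r / (r.factorial : ℝ)

/-- The dual Hahn polynomial `E_k`, evaluated at `u`. -/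
def dualHahn (n l k : ℕ) (u : ℝ) : ℝ :=
  (-1 : ℝ) ^ k * (l.choose k : ℝ) * hyp32 (-k) (-l + u) (n - l - u + 1) (-l) 1 1

/-- `λ(j) = 2^{-n} ∑_{k=0}^{l} p^{2k} α_k(j)`, from the numbers `a k = α_k(j)`. -/
def lam (n l : ℕ) (p : ℝ) (a : ℕ → ℝ) : ℝ :=
  1 / 2 ^ n * ∑ k ∈ Finset.range (l + 1), p ^ (2 * k) * a k

end

/-! Identify bit strings with subsets of an n-set. The maps `raise` and `lower` are mutually adjoint
and satisfy an sl₂ commutation relation. Let `B_j` be the image under `raise ^ (l - j)` of the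
harmonic functions of degree j, those on j-sets killed by `lower`. The relation shows that `raise ^
r * lower ^ r` acts on `B_j` as an explicit product of binomials (`raise_pow_lower_pow_raise_pow`).
Its kernel is r!² · C(|s ∩ t|, l - r), so binomial inversion expresses every `A_k` through these
operators, and `α_k(j)` comes out as `alphaScheme`.

The `B_j` are orthogonal by adjointness. Rank–nullity bounds each dimension below by C(n,j) -
C(n,j-1). These bounds telescope to C(n,l), the dimension of the whole space, so every bound is
sharp and the `B_j` exhaust it (`finrank_harmonicSpace`, `iSup_weightComponent`).

Entries of ρ^{⊗n} depend only on Hamming distance, so `rhoL` is a combination of the `A_k`. The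
first two closed forms agree because both equal the Eberlein polynomial; the hypergeometric form is
`alphaScheme` term by term. -/

/-! ### Binomial identities behind the closed forms. -/

-- Vandermonde gives C(b+r,r) = Σ C(b,t) C(r,t). After C(a,r) C(r,t) = C(a,t) C(a-t,r-t), the sum
-- over r is the expansion of (X + (1 - X))^(a-t) = 1.
open Polynomial in
theorem sum_choose_mul_choose_add_eq_coeff (a b : ℕ) :
    ∑ r ∈ Finset.range (a + 1),
      (((a.choose r * (b + r).choose r : ℕ) : ℤ[X]) * (X ^ r * (1 - X) ^ (a - r)))
      = ∑ t ∈ Finset.range (a + 1), ((a.choose t * b.choose t : ℕ) : ℤ[X]) * X ^ t := by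
  have expand : ∀ r, (b + r).choose r
      = ∑ t ∈ Finset.range (r + 1), b.choose t * r.choose t := by
    intro r
    rw [Nat.add_choose_eq, Finset.Nat.sum_antidiagonal_eq_sum_range_succ_mk]
    refine Finset.sum_congr rfl fun t ht => ?_
    rw [Nat.choose_symm (by simpa [Nat.lt_succ_iff] using ht)]
  calc _ = ∑ r ∈ Finset.range (a + 1), ∑ t ∈ Finset.range (r + 1),
        ((a.choose t * b.choose t * (a - t).choose (r - t) : ℕ) : ℤ[X])
          * (X ^ r * (1 - X) ^ (a - r)) := by
        refine Finset.sum_congr rfl fun r hr => ?_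
        rw [← Finset.sum_mul, expand, Finset.mul_sum]
        push_cast
        congr 1
        refine Finset.sum_congr rfl fun t ht => ?_
        have h := Nat.choose_mul (n := a) (k := r) (s := t)
          (by simpa [Nat.lt_succ_iff] using ht)
        have h' : ((a.choose r : ℕ) : ℤ[X]) * (r.choose t : ℕ)
          = (a.choose t : ℕ) * ((a - t).choose (r - t) : ℕ) := by exact_mod_cast h
        linear_combination (b.choose t : ℤ[X]) * h'
    _ = ∑ t ∈ Finset.range (a + 1), ∑ r ∈ Finset.Ico t (a + 1),
        ((a.choose t * b.choose t * (a - t).choose (r - t) : ℕ) : ℤ[X])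
          * (X ^ r * (1 - X) ^ (a - r)) := by
        refine Finset.sum_comm' fun r t => ?_
        simp only [Finset.mem_range, Finset.mem_Ico]
        omega
    _ = _ := by
        refine Finset.sum_congr rfl fun t ht => ?_
        have ht' : t ≤ a := by simpa [Nat.lt_succ_iff] using ht
        rw [Finset.sum_Ico_eq_sum_range, show a + 1 - t = (a - t) + 1 by omega]
        have hb := add_pow (X : ℤ[X]) (1 - X) (a - t)
        rw [add_sub_cancel, one_pow] at hb
        conv_rhs => rw [← mul_one (X ^ t), hb, Finset.mul_sum, Finset.mul_sum]
        refine Finset.sum_congr rfl fun s _ => ?_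
        rw [show t + s - t = s by omega, show a - (t + s) = a - t - s by omega, pow_add]
        push_cast
        ring

open Polynomial in
theorem coeff_one_sub_X_pow (m i : ℕ) :
    ((1 - X : ℤ[X]) ^ m).coeff i = (-1) ^ i * (m.choose i : ℤ) := by
  have h : (1 - X : ℤ[X]) ^ m = ((1 + X : ℤ[X]) ^ m).comp (C (-1) * X) := by
    simp [sub_eq_add_neg]
  rw [h, comp_C_mul_X_coeff, coeff_one_add_X_pow, mul_comm]

/-- The Eberlein polynomial, the symmetric form of the eigenvalues of the Johnson scheme. -/
def eberlein (a b j k : ℕ) : ℤ :=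
  ∑ t ∈ Finset.range (k + 1),
    (-1) ^ (k - t) * (j.choose (k - t) : ℤ) * (a.choose t : ℤ) * (b.choose t : ℤ)

-- Multiply the preceding polynomial identity by (1 - X)^j and compare coefficients of X^k.
open Polynomial in
theorem sum_choose_sub_eq_eberlein (a b j k : ℕ) :
    ∑ r ∈ Finset.range (k + 1),
      (-1 : ℤ) ^ (k - r) * ((a + j - r).choose (k - r) : ℤ) * (a.choose r : ℤ)
        * ((b + r).choose r : ℤ) = eberlein a b j k := by
  have key := congrArg (fun P : ℤ[X] => ((1 - X) ^ j * P).coeff k)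
    (sum_choose_mul_choose_add_eq_coeff a b)
  simp only [Finset.mul_sum, finsetSum_coeff] at key
  -- Terms vanish beyond both a and k, so either may serve as the upper limit.
  have extend : ∀ f : ℕ → ℤ, (∀ r, k < r → f r = 0) → (∀ r, a < r → f r = 0) →
      ∑ r ∈ Finset.range (a + 1), f r = ∑ r ∈ Finset.range (k + 1), f r := by
    intro f hk ha
    trans ∑ r ∈ Finset.range (a + k + 1), f r
    · exact Finset.sum_subset (Finset.range_mono (by omega))
        fun r _ hr => ha r (by simpa [Nat.lt_succ_iff] using hr)
    · exact (Finset.sum_subset (Finset.range_mono (by omega))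
        fun r _ hr => hk r (by simpa [Nat.lt_succ_iff] using hr)).symm
  have coeff_left : ∀ r, ((1 - X : ℤ[X]) ^ j * (((a.choose r * (b + r).choose r : ℕ) : ℤ[X])
      * (X ^ r * (1 - X) ^ (a - r)))).coeff k
      = if r ≤ k then (-1 : ℤ) ^ (k - r) * ((a + j - r).choose (k - r) : ℤ) * (a.choose r : ℤ)
        * ((b + r).choose r : ℤ) else 0 := by
    intro r
    rcases le_or_gt r a with hra | hra
    · rw [show (1 - X : ℤ[X]) ^ j * (((a.choose r * (b + r).choose r : ℕ) : ℤ[X])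
        * (X ^ r * (1 - X) ^ (a - r))) = ((a.choose r * (b + r).choose r : ℕ) : ℤ[X])
          * ((1 - X) ^ (j + (a - r)) * X ^ r) by ring, ← C_eq_natCast, coeff_C_mul,
        coeff_mul_X_pow', coeff_one_sub_X_pow, show j + (a - r) = a + j - r by omega]
      split_ifs <;> push_cast <;> ring
    · simp [Nat.choose_eq_zero_of_lt hra]
  have coeff_right : ∀ t, ((1 - X : ℤ[X]) ^ j * (((a.choose t * b.choose t : ℕ) : ℤ[X])
      * X ^ t)).coeff k = if t ≤ k then (-1 : ℤ) ^ (k - t) * (j.choose (k - t) : ℤ)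
        * (a.choose t : ℤ) * (b.choose t : ℤ) else 0 := by
    intro t
    rw [mul_left_comm, ← C_eq_natCast, coeff_C_mul, coeff_mul_X_pow', coeff_one_sub_X_pow]
    split_ifs <;> push_cast <;> ring
  simp only [coeff_left, coeff_right] at key
  rw [extend _ (fun r hr => if_neg (by omega))
    (fun r hr => by simp [Nat.choose_eq_zero_of_lt hr]),
    extend _ (fun r hr => if_neg (by omega))
    (fun r hr => by simp [Nat.choose_eq_zero_of_lt hr])] at key
  refine Eq.trans ?_ (key.trans ?_)
  · refine Finset.sum_congr rfl fun r hr => ?_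
    rw [if_pos (by simpa [Nat.lt_succ_iff] using hr)]
  · refine Finset.sum_congr rfl fun r hr => ?_
    rw [if_pos (by simpa [Nat.lt_succ_iff] using hr)]

/-- Pascal's rule C(N,t) - C(N-1,t-1) = C(N-1,t), iterated m times starting from N = b + m. -/
theorem sum_alternating_choose_mul_choose_sub (m b t : ℕ) :
    ∑ s ∈ Finset.range (t + 1),
      (-1 : ℤ) ^ s * (m.choose s : ℤ) * ((b + m - s).choose (t - s) : ℤ)
      = (b.choose t : ℤ) := by
  induction m generalizing b t with
  | zero =>
    rw [Finset.sum_eq_single_of_mem 0 (by simp)]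
    · simp
    · intro s _ hs
      obtain ⟨s, rfl⟩ := Nat.exists_eq_succ_of_ne_zero hs
      simp
  | succ m ih =>
    cases t with
    | zero => simp
    | succ t =>
      have h1 := ih (b + 1) (t + 1)
      have h2 := ih b t
      rw [Finset.sum_range_succ'] at h1 ⊢
      have : ∀ s ∈ Finset.range (t + 1),
          (-1 : ℤ) ^ (s + 1) * ((m + 1).choose (s + 1) : ℤ)
            * ((b + (m + 1) - (s + 1)).choose (t + 1 - (s + 1)) : ℤ)
          = (-1 : ℤ) ^ (s + 1) * (m.choose (s + 1) : ℤ)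
            * ((b + 1 + m - (s + 1)).choose (t + 1 - (s + 1)) : ℤ)
            - (-1 : ℤ) ^ s * (m.choose s : ℤ) * ((b + m - s).choose (t - s) : ℤ) := by
        intro s _
        rw [Nat.choose_succ_succ, show b + (m + 1) - (s + 1) = b + m - s by omega,
          show b + 1 + m - (s + 1) = b + m - s by omega, show t + 1 - (s + 1) = t - s by omega]
        push_cast
        ring
      rw [Finset.sum_congr rfl this, Finset.sum_sub_distrib, h2]
      have h3 : ((b + 1).choose (t + 1) : ℤ) = b.choose t + b.choose (t + 1) := by
        exact_mod_cast Nat.choose_succ_succ b t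
      rw [h3] at h1
      rw [show b + (m + 1) - 0 = b + 1 + m - 0 by omega]
      simp only [Nat.choose_zero_right] at h1 ⊢
      linarith

/-- Expand C(a+s,k) by Vandermonde and use C(j,s) C(s,u) = C(j,u) C(j-u,s-u). The sum over s then
collapses by the preceding lemma. -/
theorem sum_choose_add_eq_eberlein (a b j k : ℕ) :
    ∑ s ∈ Finset.range (k + 1),
      (-1 : ℤ) ^ s * ((a + s).choose k : ℤ) * ((b + j - s).choose (k - s) : ℤ)
        * (j.choose s : ℤ) = eberlein a b j k := by
  have vand : ∀ s, ((a + s).choose k : ℤ)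
      = ∑ u ∈ Finset.range (k + 1), (a.choose (k - u) : ℤ) * (s.choose u : ℤ) := by
    intro s
    rw [add_comm a s, Nat.add_choose_eq, Finset.Nat.sum_antidiagonal_eq_sum_range_succ_mk]
    push_cast
    exact Finset.sum_congr rfl fun u _ => mul_comm _ _
  calc _ = ∑ s ∈ Finset.range (k + 1), ∑ u ∈ Finset.range (k + 1),
        (-1 : ℤ) ^ s * ((a.choose (k - u) : ℤ) * (s.choose u : ℤ))
          * ((b + j - s).choose (k - s) : ℤ) * (j.choose s : ℤ) := by
        refine Finset.sum_congr rfl fun s _ => ?_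
        rw [vand, Finset.mul_sum, Finset.sum_mul, Finset.sum_mul]
    _ = ∑ u ∈ Finset.range (k + 1), ∑ s ∈ Finset.range (k + 1),
        (-1 : ℤ) ^ s * ((a.choose (k - u) : ℤ) * (s.choose u : ℤ))
          * ((b + j - s).choose (k - s) : ℤ) * (j.choose s : ℤ) := Finset.sum_comm
    _ = ∑ u ∈ Finset.range (k + 1), (-1 : ℤ) ^ u * (j.choose u : ℤ)
          * (a.choose (k - u) : ℤ) * (b.choose (k - u) : ℤ) := by
        refine Finset.sum_congr rfl fun u hu => ?_
        have huk : u ≤ k := by simpa [Nat.lt_succ_iff] using hu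
        rcases lt_or_ge j u with hju | hju
        · rw [Nat.choose_eq_zero_of_lt hju]
          simp only [Nat.cast_zero, mul_zero, zero_mul]
          refine Finset.sum_eq_zero fun s _ => ?_
          rcases lt_or_ge s u with h | h
          · simp [Nat.choose_eq_zero_of_lt h]
          · simp [Nat.choose_eq_zero_of_lt (lt_of_lt_of_le hju h)]
        · rw [← sum_alternating_choose_mul_choose_sub (j - u) b (k - u), Finset.mul_sum,
            ← Finset.sum_subset (s₁ := Finset.Ico u (k + 1)), Finset.sum_Ico_eq_sum_range,
            show k + 1 - u = k - u + 1 by omega]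
          · refine Finset.sum_congr rfl fun s _ => ?_
            have h : ((j.choose (u + s) : ℕ) : ℤ) * ((u + s).choose u : ℕ)
                = (j.choose u : ℕ) * ((j - u).choose s : ℕ) := by
              have := Nat.choose_mul (n := j) (k := u + s) (s := u) (by omega)
              rw [show u + s - u = s by omega] at this
              exact_mod_cast this
            rw [show b + j - (u + s) = b + (j - u) - s by omega,
              show k - (u + s) = k - u - s by omega, pow_add]
            linear_combination (-1 : ℤ) ^ u * (-1) ^ s * (a.choose (k - u) : ℤ)
              * ((b + (j - u) - s).choose (k - u - s) : ℤ) * h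
          · intro s; simp
          · intro s hs hs'
            have : s < u := by
              simp only [Finset.mem_range, Finset.mem_Ico, not_and, not_lt] at hs hs'
              by_contra h
              exact absurd (hs' (by omega)) (by omega)
            simp [Nat.choose_eq_zero_of_lt this]
    _ = _ := by
        rw [eberlein, ← Finset.sum_range_reflect]
        refine Finset.sum_congr rfl fun u hu => ?_
        have huk : u ≤ k := by simpa [Nat.lt_succ_iff] using hu
        rw [show k + 1 - 1 - u = k - u by omega, show k - (k - u) = u by omega]

theorem alphaScheme_eq_eberlein {n l j : ℕ} (k : ℕ) (hjl : j ≤ l) :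
    alphaScheme n l k j = (eberlein (l - j) (n - l - j) j k : ℝ) := by
  rw [← sum_choose_sub_eq_eberlein, alphaScheme]
  push_cast
  rw [show l - j + j = l by omega]

theorem alphaYoung_eq_eberlein {n l j k : ℕ} (hjn : j ≤ n - l) :
    alphaYoung n l k j = (eberlein (l - j) (n - l - j) j k : ℝ) := by
  have reflect := Finset.sum_range_reflect (fun s =>
    (-1 : ℤ) ^ s * ((l - j + s).choose k : ℤ) * ((n - l - j + j - s).choose (k - s) : ℤ)
        * (j.choose s : ℤ)) (k + 1)
  rw [← sum_choose_add_eq_eberlein, ← reflect, alphaYoung]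
  push_cast
  rw [show n - l - j + j = n - l by omega]
  symm
  -- Below this interval C(j,k-r) vanishes, and above it, for r ≤ k, C(l-j+k-r,k) does.
  rw [← Finset.sum_subset (s₁ := Finset.Icc (k - j) (min k (l - j)))]
  · refine Finset.sum_congr rfl fun r hr => ?_
    simp only [Finset.mem_Icc, le_min_iff] at hr
    rw [show l - j + (k - r) = l - j + k - r by omega,
      show n - l - (k - r) = n - l + r - k by omega, show k - (k - r) = r by omega]
  · intro r; simp; omega
  · intro r hr hr'
    simp only [Finset.mem_Icc, le_min_iff, Finset.mem_range] at hr hr'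
    rcases lt_or_ge r (k - j) with h | h
    · rw [Nat.choose_eq_zero_of_lt (show j < k - r by omega)]; simp
    · rw [Nat.choose_eq_zero_of_lt (show l - j + (k - r) < k by omega)]; simp

/-! ### Pochhammer symbols and the hypergeometric form. -/

theorem ascPochhammer_eval_neg_natCast {m r : ℕ} (h : r ≤ m) :
    (ascPochhammer ℝ r).eval (-(m : ℝ)) = (-1) ^ r * (m.factorial / (m - r).factorial : ℝ) := by
  rw [ascPochhammer_eval_neg_eq_descPochhammer, descPochhammer_eval_eq_descFactorial,
    ← Nat.factorial_mul_descFactorial h]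
  have := Nat.factorial_ne_zero (m - r)
  push_cast
  field_simp

theorem ascPochhammer_eval_neg_natCast_of_lt {m r : ℕ} (h : m < r) :
    (ascPochhammer ℝ r).eval (-(m : ℝ)) = 0 := by
  rw [ascPochhammer_eval_neg_eq_descPochhammer, descPochhammer_eval_eq_descFactorial,
    Nat.descFactorial_of_lt h]
  simp

theorem ascPochhammer_eval_natCast_add_one (m r : ℕ) :
    (ascPochhammer ℝ r).eval ((m : ℝ) + 1) = ((m + r).factorial / m.factorial : ℝ) := by
  have h' := Nat.factorial_mul_ascFactorial m r
  have : (ascPochhammer ℝ r).eval ((m : ℝ) + 1) = ((m + 1).ascFactorial r : ℝ) := by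
    rw [← ascPochhammer_nat_eq_ascFactorial, ascPochhammer_eval_cast]
    push_cast
    rfl
  rw [this, ← h']
  have := Nat.factorial_ne_zero m
  push_cast
  field_simp

theorem dualHahn_eq_alphaScheme {n l j k : ℕ} (hk : k ≤ l) (hln : l ≤ n) (hjl : j ≤ l)
    (hjn : j ≤ n - l) : dualHahn n l k (j : ℝ) = alphaScheme n l k j := by
  rw [dualHahn, hyp32, tsum_eq_sum (s := Finset.range (k + 1)), Finset.mul_sum, alphaScheme]
  · refine Finset.sum_congr rfl fun r hr => ?_
    have hrk : r ≤ k := by simpa [Nat.lt_succ_iff] using hr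
    obtain ⟨i, rfl⟩ := Nat.exists_eq_add_of_le hrk
    have hc : (n : ℝ) - l - j + 1 = ((n - l - j : ℕ) : ℝ) + 1 := by
      rw [Nat.cast_sub hjn, Nat.cast_sub hln]
    have hb : -(l : ℝ) + j = -((l - j : ℕ) : ℝ) := by
      rw [Nat.cast_sub hjl]; ring
    have h1 : (ascPochhammer ℝ r).eval (1 : ℝ) = r.factorial := by
      simp
    rw [hc, hb, ascPochhammer_eval_natCast_add_one, h1, ascPochhammer_eval_neg_natCast hrk,
      ascPochhammer_eval_neg_natCast (hrk.trans hk), show r + i - r = i by omega]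
    -- For r > l - j the series stops because of its second parameter, matching C(l-j,r) = 0.
    rcases lt_or_ge (l - j) r with hlt | hle
    · rw [ascPochhammer_eval_neg_natCast_of_lt hlt, Nat.choose_eq_zero_of_lt hlt]
      simp
    · rw [ascPochhammer_eval_neg_natCast hle, Nat.cast_choose ℝ hk, Nat.cast_choose ℝ hle,
        Nat.cast_choose ℝ (show i ≤ l - r by omega),
        Nat.cast_choose ℝ (show r ≤ n - l - j + r by omega),
        show n - l - j + r - r = n - l - j by omega, show l - r - i = l - (r + i) by omega, pow_add]
      have hs : ((-1 : ℝ) ^ r) * (-1) ^ r = 1 := by rw [← mul_pow]; simp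
      have := Nat.factorial_ne_zero (l - r)
      have := Nat.factorial_ne_zero l
      have := Nat.factorial_ne_zero (r + i)
      field_simp
      linear_combination hs
  · intro r hr
    rw [ascPochhammer_eval_neg_natCast_of_lt (by simpa [Nat.lt_succ_iff] using hr)]
    simp

/-! ### The sl₂ action on the Boolean lattice. -/

section BooleanLattice

variable {ι : Type*} [Fintype ι] [DecidableEq ι]

/-- The lowering operator on functions on the Boolean lattice:
`(lower f) s` is the sum of `f` over the sets covering `s`. -/
def lower : Module.End ℂ (Finset ι → ℂ) where
  toFun f s := ∑ i ∈ sᶜ, f (insert i s)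
  map_add' f g := by ext s; simp [Finset.sum_add_distrib]
  map_smul' c f := by ext s; simp [Finset.mul_sum]

/-- The raising operator on functions on the Boolean lattice:
`(raise f) s` is the sum of `f` over the sets covered by `s`. -/
def raise : Module.End ℂ (Finset ι → ℂ) where
  toFun f s := ∑ i ∈ s, f (s.erase i)
  map_add' f g := by ext s; simp [Finset.sum_add_distrib]
  map_smul' c f := by ext s; simp [Finset.mul_sum]

theorem lower_apply (f : Finset ι → ℂ) (s : Finset ι) :
    lower f s = ∑ i ∈ sᶜ, f (insert i s) := rfl

omit [Fintype ι] in
theorem raise_apply (f : Finset ι → ℂ) (s : Finset ι) :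
    raise f s = ∑ i ∈ s, f (s.erase i) := rfl

/-- Exchanges of an element of s for one outside s contribute equally to both orders of composition.
Only the returns to s differ: n - |s| of them against |s|. -/
theorem lower_raise_apply (f : Finset ι → ℂ) (s : Finset ι) :
    lower (raise f) s = raise (lower f) s + ((Fintype.card ι : ℂ) - 2 * s.card) * f s := by
  have h1 : lower (raise f) s
      = ∑ i ∈ sᶜ, (f s + ∑ j ∈ s, f ((insert i s).erase j)) := by
    refine Finset.sum_congr rfl fun i hi => ?_
    have hi' : i ∉ s := by simpa using hi
    rw [raise_apply, Finset.sum_insert hi', Finset.erase_insert hi']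
  have h2 : raise (lower f) s
      = ∑ j ∈ s, (f s + ∑ i ∈ sᶜ, f ((insert i s).erase j)) := by
    refine Finset.sum_congr rfl fun j hj => ?_
    rw [lower_apply, Finset.compl_erase, Finset.sum_insert (by simpa using hj),
      Finset.insert_erase hj]
    congr 1
    refine Finset.sum_congr rfl fun i hi => ?_
    rw [Finset.erase_insert_of_ne]
    rintro rfl
    exact (Finset.mem_compl.mp hi) hj
  rw [h1, h2, Finset.sum_add_distrib, Finset.sum_add_distrib, Finset.sum_comm]
  have : (Fintype.card ι : ℂ) = s.card + sᶜ.card := by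
    exact_mod_cast (Finset.card_add_card_compl s).symm
  rw [this]
  simp only [Finset.sum_const, nsmul_eq_mul]
  ring

/-- The functions supported on sets `s` with `s.card + d = j`. -/
def shiftedLevel (ι : Type*) (d j : ℕ) : Submodule ℂ (Finset ι → ℂ) where
  carrier := {f | ∀ s, s.card + d ≠ j → f s = 0}
  add_mem' hf hg s hs := by simp [hf s hs, hg s hs]
  zero_mem' _ _ := rfl
  smul_mem' c f hf s hs := by simp [hf s hs]

/-- The functions supported on the sets of cardinality `j`. -/
abbrev level (ι : Type*) (j : ℕ) : Submodule ℂ (Finset ι → ℂ) := shiftedLevel ι 0 j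

omit [Fintype ι] [DecidableEq ι] in
theorem mem_level {j : ℕ} {f : Finset ι → ℂ} :
    f ∈ level ι j ↔ ∀ s, s.card ≠ j → f s = 0 := Iff.rfl

omit [Fintype ι] in
theorem raise_mem_level {j : ℕ} {f : Finset ι → ℂ} (hf : f ∈ level ι j) :
    raise f ∈ level ι (j + 1) := by
  intro s hs
  refine Finset.sum_eq_zero fun i hi => hf _ ?_
  rw [← Finset.card_erase_add_one hi] at hs
  omega

omit [Fintype ι] in
theorem raise_pow_mem_level {j : ℕ} {f : Finset ι → ℂ} (hf : f ∈ level ι j) (m : ℕ) :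
    (raise ^ m) f ∈ level ι (j + m) := by
  induction m with
  | zero => simpa using hf
  | succ m ih => rw [pow_succ', Module.End.mul_apply]; exact raise_mem_level ih

/-- The target is level j - 1 without truncated subtraction: for j = 0 it is the zero space. -/
theorem lower_mem_shiftedLevel {j : ℕ} {f : Finset ι → ℂ} (hf : f ∈ level ι j) :
    lower f ∈ shiftedLevel ι 1 j := by
  intro s hs
  refine Finset.sum_eq_zero fun i hi => hf _ ?_
  rw [Finset.card_insert_of_notMem (by simpa using hi)]
  omega

theorem lower_raise_of_mem_level {j : ℕ} {f : Finset ι → ℂ} (hf : f ∈ level ι j) :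
    lower (raise f) = raise (lower f) + ((Fintype.card ι : ℂ) - 2 * j) • f := by
  ext s
  rw [lower_raise_apply]
  by_cases hs : s.card = j
  · simp [hs]
  · simp [mem_level.mp hf s hs]

/-- The harmonic functions of degree `j`. -/
def harmonicSpace (ι : Type*) [Fintype ι] [DecidableEq ι] (j : ℕ) : Submodule ℂ (Finset ι → ℂ) :=
  level ι j ⊓ LinearMap.ker lower

/-- Each commutation past a `raise` adds a weight n - 2j - 2i; the scalar is their sum over i ≤ m.
-/
theorem lower_raise_pow_succ {j : ℕ} {f : Finset ι → ℂ} (hf : f ∈ harmonicSpace ι j) (m : ℕ) :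
    lower ((raise ^ (m + 1)) f)
      = ((m + 1 : ℂ) * ((Fintype.card ι : ℂ) - 2 * j - m)) • (raise ^ m) f := by
  induction m with
  | zero =>
    have h0 : lower f = 0 := hf.2
    simp [lower_raise_of_mem_level hf.1, h0]
  | succ m ih =>
    rw [pow_succ', Module.End.mul_apply,
      lower_raise_of_mem_level (raise_pow_mem_level hf.1 (m + 1)), ih, map_smul,
      ← Module.End.mul_apply, ← pow_succ', ← add_smul]
    congr 1
    push_cast
    ring

/-- On level l = j + m one has q = n - l - j; naming it keeps the scalars in ℕ. Past r = m both
sides vanish. -/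
theorem lower_pow_raise_pow {j m q : ℕ} (hq : Fintype.card ι = 2 * j + m + q)
    {f : Finset ι → ℂ} (hf : f ∈ harmonicSpace ι j) (r : ℕ) :
    (lower ^ r) ((raise ^ m) f)
      = ((m.descFactorial r * (q + 1).ascFactorial r : ℕ) : ℂ) • (raise ^ (m - r)) f := by
  induction r with
  | zero => simp
  | succ r ih =>
    rw [pow_succ', Module.End.mul_apply, ih, map_smul]
    rcases lt_trichotomy r m with h | rfl | h
    · obtain ⟨t, rfl⟩ := Nat.exists_eq_add_of_lt h
      rw [show r + t + 1 - r = t + 1 by omega, lower_raise_pow_succ hf,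
        show r + t + 1 - (r + 1) = t by omega, smul_smul, Nat.descFactorial_succ,
        Nat.ascFactorial_succ, hq, show r + t + 1 - r = t + 1 by omega]
      congr 1
      push_cast
      ring
    · have h0 : lower f = 0 := hf.2
      simp [h0]
    · simp [Nat.descFactorial_of_lt h]

theorem raise_pow_lower_pow_raise_pow {j m q : ℕ} (hq : Fintype.card ι = 2 * j + m + q)
    {f : Finset ι → ℂ} (hf : f ∈ harmonicSpace ι j) (r : ℕ) :
    (raise ^ r) ((lower ^ r) ((raise ^ m) f))
      = ((r.factorial : ℂ) ^ 2 * (m.choose r) * ((q + r).choose r)) • (raise ^ m) f := by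
  rw [lower_pow_raise_pow hq hf, map_smul, ← Module.End.mul_apply, ← pow_add]
  rcases le_or_gt r m with h | h
  · rw [show r + (m - r) = m by omega, Nat.descFactorial_eq_factorial_mul_choose,
      Nat.ascFactorial_eq_factorial_mul_choose]
    congr 1
    push_cast
    ring
  · simp [Nat.descFactorial_of_lt h, Nat.choose_eq_zero_of_lt h]

/-- Both sides sum over the covering pairs s \ {i} ⊂ s. -/
theorem star_raise_dotProduct (f g : Finset ι → ℂ) :
    star (raise f) ⬝ᵥ g = star f ⬝ᵥ lower g := by
  simp only [dotProduct, Pi.star_apply, raise_apply, lower_apply, star_sum, Finset.sum_mul,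
    Finset.mul_sum]
  rw [Finset.sum_sigma', Finset.sum_sigma']
  refine Finset.sum_bij' (fun x _ => ⟨x.1.erase x.2, x.2⟩) (fun x _ => ⟨insert x.2 x.1, x.2⟩)
    ?_ ?_ ?_ ?_ ?_
  · rintro ⟨s, i⟩ h; simp
  · rintro ⟨s, i⟩ h; simp
  · rintro ⟨s, i⟩ h; simp at h; simp [Finset.insert_erase h]
  · rintro ⟨s, i⟩ h; simp at h; simp [Finset.erase_insert h]
  · rintro ⟨s, i⟩ h; simp at h; simp [Finset.insert_erase h]

theorem star_raise_pow_dotProduct (m : ℕ) (f g : Finset ι → ℂ) :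
    star ((raise ^ m) f) ⬝ᵥ g = star f ⬝ᵥ (lower ^ m) g := by
  induction m generalizing g with
  | zero => simp
  | succ m ih =>
    rw [pow_succ', Module.End.mul_apply, star_raise_dotProduct, ih, pow_succ,
      Module.End.mul_apply]

/-- The `j`-th harmonic component of the functions on the sets of cardinality `l`. -/
def harmonicComponent (ι : Type*) [Fintype ι] [DecidableEq ι] (l j : ℕ) :
    Submodule ℂ (Finset ι → ℂ) :=
  (harmonicSpace ι j).map (raise ^ (l - j))

theorem harmonicComponent_le_level {l j : ℕ} (hj : j ≤ l) :
    harmonicComponent ι l j ≤ level ι l := by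
  rintro _ ⟨f, hf, rfl⟩
  simpa [hj] using raise_pow_mem_level hf.1 (l - j)

/-- By adjointness `lower ^ (l - i)` falls on `raise ^ (l - j) g`; since l - i > l - j, it gives
zero. -/
theorem dotProduct_harmonicComponent_eq_zero {l i j : ℕ} (hij : i < j) (hj : j ≤ l)
    (hjn : j + l ≤ Fintype.card ι) {f g : Finset ι → ℂ}
    (hf : f ∈ harmonicComponent ι l i) (hg : g ∈ harmonicComponent ι l j) :
    star f ⬝ᵥ g = 0 := by
  obtain ⟨f, hf, rfl⟩ := hf
  obtain ⟨g, hg, rfl⟩ := hg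
  rw [star_raise_pow_dotProduct, lower_pow_raise_pow (q := Fintype.card ι - (j + l)) (by omega) hg,
    Nat.descFactorial_of_lt (show l - j < l - i by omega)]
  simp

/-- `raise ^ (l - j)` is injective on harmonic functions, since applying `lower ^ (l - j)`
afterwards gives a nonzero scalar. -/
theorem finrank_harmonicComponent {l j : ℕ} (hj : j ≤ l) (hjn : j + l ≤ Fintype.card ι) :
    Module.finrank ℂ (harmonicComponent ι l j) = Module.finrank ℂ (harmonicSpace ι j) := by
  have hinj : Function.Injective ((raise ^ (l - j)).domRestrict (harmonicSpace ι j)) := by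
    rw [← LinearMap.ker_eq_bot, LinearMap.ker_eq_bot']
    rintro ⟨f, hf⟩ h
    have h0 := lower_pow_raise_pow (m := l - j) (q := Fintype.card ι - (j + l)) (by omega) hf (l - j)
    have h1 : (raise ^ (l - j)) f = 0 := h
    rw [h1, map_zero, eq_comm, smul_eq_zero] at h0
    rcases h0 with h0 | h0
    · exact absurd h0 (by
        have := Nat.ascFactorial_pos (Fintype.card ι - (j + l)) (l - j)
        rw [Nat.descFactorial_self]
        exact_mod_cast (Nat.mul_pos (Nat.factorial_pos _) this).ne')
    · simpa using h0
  rw [harmonicComponent, ← LinearMap.range_domRestrict]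
  exact LinearMap.finrank_range_of_inj hinj

omit [DecidableEq ι] in
theorem finrank_shiftedLevel (d j : ℕ) : Module.finrank ℂ (shiftedLevel ι d j)
    = (Finset.univ.filter fun s : Finset ι => s.card + d = j).card := by
  have h : shiftedLevel ι d j = ⨅ s ∈ {s : Finset ι | s.card + d ≠ j},
      LinearMap.ker (LinearMap.proj s : (Finset ι → ℂ) →ₗ[ℂ] ℂ) := by
    ext f
    simp [shiftedLevel]
  have e := LinearMap.iInfKerProjEquiv ℂ (fun _ : Finset ι => ℂ)
    (I := {s : Finset ι | s.card + d = j}) (J := {s : Finset ι | s.card + d ≠ j})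
    (by rw [Set.disjoint_left]; intro s hs; simpa using hs)
    (by intro s _; by_cases hs : s.card + d = j <;> simp [hs])
  rw [h, LinearEquiv.finrank_eq e, Module.finrank_fintype_fun_eq_card, Fintype.card_subtype]
  rfl

omit [DecidableEq ι] in
theorem finrank_level (j : ℕ) : Module.finrank ℂ (level ι j) = (Fintype.card ι).choose j := by
  rw [finrank_shiftedLevel, ← Fintype.card_finset_len, Fintype.card_subtype]
  rfl

omit [DecidableEq ι] in
theorem finrank_shiftedLevel_one_succ (j : ℕ) :
    Module.finrank ℂ (shiftedLevel ι 1 (j + 1)) = (Fintype.card ι).choose j := by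
  rw [finrank_shiftedLevel, ← Fintype.card_finset_len, Fintype.card_subtype]
  simp

omit [DecidableEq ι] in
theorem finrank_shiftedLevel_one_zero : Module.finrank ℂ (shiftedLevel ι 1 0) = 0 := by
  rw [finrank_shiftedLevel]
  simp

/-- Rank–nullity for `lower` on level j; this is the lower bound in the dimension count. -/
theorem finrank_level_le (j : ℕ) : Module.finrank ℂ (level ι j)
    ≤ Module.finrank ℂ (harmonicSpace ι j) + Module.finrank ℂ (shiftedLevel ι 1 j) := by
  rw [← (lower.domRestrict (level ι j)).finrank_range_add_finrank_ker, add_comm]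
  refine add_le_add ?_ (Submodule.finrank_mono ?_)
  · rw [← Submodule.finrank_map_subtype_eq]
    refine Submodule.finrank_mono ?_
    rintro _ ⟨⟨f, hf⟩, hf', rfl⟩
    exact ⟨hf, hf'⟩
  · rw [LinearMap.range_domRestrict]
    rintro _ ⟨f, hf, rfl⟩
    exact lower_mem_shiftedLevel hf

/-! ### Kernels of the iterated operators and the Johnson scheme. -/

/-- The factor r! counts the orders in which the elements of t \ s can be added. -/
theorem lower_pow_apply (r : ℕ) (f : Finset ι → ℂ) (s : Finset ι) :
    (lower ^ r) f s = r.factorial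
      * ∑ t ∈ Finset.univ.filter (fun t => s ⊆ t ∧ t.card = s.card + r), f t := by
  induction r generalizing s with
  | zero =>
    have : Finset.univ.filter (fun t => s ⊆ t ∧ t.card = s.card + 0) = {s} := by
      ext t
      simp only [Finset.mem_filter, Finset.mem_univ, true_and, Finset.mem_singleton]
      refine ⟨fun h => (Finset.eq_of_subset_of_card_le h.1 h.2.le).symm, ?_⟩
      rintro rfl; simp
    rw [this]
    simp
  | succ r ih =>
    rw [pow_succ', Module.End.mul_apply, lower_apply, Finset.sum_congr rfl fun i _ => ih _,
      ← Finset.mul_sum, Finset.sum_comm' (t' := Finset.univ.filter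
        (fun t => s ⊆ t ∧ t.card = s.card + (r + 1))) (s' := fun t => t \ s)]
    · rw [Finset.sum_congr rfl (g := fun t => ((r + 1 : ℕ) : ℂ) * f t), ← Finset.mul_sum,
        Nat.factorial_succ]
      · push_cast
        ring
      · intro t ht
        simp only [Finset.mem_filter, Finset.mem_univ, true_and] at ht
        rw [Finset.sum_const, Finset.card_sdiff_of_subset ht.1, nsmul_eq_mul, ht.2]
        congr 2
        omega
    · intro i t
      simp only [Finset.mem_compl, Finset.mem_filter, Finset.mem_univ, true_and,
        Finset.mem_sdiff, Finset.insert_subset_iff]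
      constructor
      · rintro ⟨hi, ⟨hit, hst⟩, hc⟩
        rw [Finset.card_insert_of_notMem hi] at hc
        exact ⟨⟨hit, hi⟩, hst, by omega⟩
      · rintro ⟨⟨hit, hi⟩, hst, hc⟩
        rw [Finset.card_insert_of_notMem hi]
        exact ⟨hi, ⟨hit, hst⟩, by omega⟩

theorem raise_pow_apply (r : ℕ) (f : Finset ι → ℂ) (s : Finset ι) :
    (raise ^ r) f s = r.factorial
      * ∑ t ∈ Finset.univ.filter (fun t => t ⊆ s ∧ t.card + r = s.card), f t := by
  induction r generalizing s with
  | zero =>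
    have : Finset.univ.filter (fun t => t ⊆ s ∧ t.card + 0 = s.card) = {s} := by
      ext t
      simp only [Finset.mem_filter, Finset.mem_univ, true_and, Finset.mem_singleton]
      refine ⟨fun h => Finset.eq_of_subset_of_card_le h.1 h.2.ge, ?_⟩
      rintro rfl; simp
    rw [this]
    simp
  | succ r ih =>
    rw [pow_succ', Module.End.mul_apply, raise_apply, Finset.sum_congr rfl fun i _ => ih _,
      ← Finset.mul_sum, Finset.sum_comm' (t' := Finset.univ.filter
        (fun t => t ⊆ s ∧ t.card + (r + 1) = s.card)) (s' := fun t => s \ t)]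
    · rw [Finset.sum_congr rfl (g := fun t => ((r + 1 : ℕ) : ℂ) * f t), ← Finset.mul_sum,
        Nat.factorial_succ]
      · push_cast
        ring
      · intro t ht
        simp only [Finset.mem_filter, Finset.mem_univ, true_and] at ht
        rw [Finset.sum_const, Finset.card_sdiff_of_subset ht.1, nsmul_eq_mul, ← ht.2]
        congr 2
        omega
    · intro i t
      simp only [Finset.mem_filter, Finset.mem_univ, true_and, Finset.mem_sdiff,
        Finset.subset_erase]
      constructor
      · rintro ⟨hi, ⟨hts, hit⟩, hc⟩
        rw [← Finset.card_erase_add_one hi]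
        exact ⟨⟨hi, hit⟩, hts, by omega⟩
      · rintro ⟨⟨hi, hit⟩, hts, hc⟩
        rw [← Finset.card_erase_add_one hi] at hc
        exact ⟨hi, ⟨hts, hit⟩, by omega⟩

/-- The paths from s to t pass through an (l-r)-subset of s ∩ t, hence the binomial. -/
theorem raise_pow_lower_pow_apply {l r : ℕ} (hr : r ≤ l) {f : Finset ι → ℂ} (hf : f ∈ level ι l)
    {s : Finset ι} (hs : s.card = l) :
    (raise ^ r) ((lower ^ r) f) s
      = (r.factorial : ℂ) ^ 2 * ∑ t, ((s ∩ t).card.choose (l - r) : ℂ) * f t := by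
  rw [raise_pow_apply, Finset.sum_congr rfl fun t _ => lower_pow_apply r f t, ← Finset.mul_sum,
    ← mul_assoc, ← sq, Finset.sum_comm' (t' := Finset.univ.filter fun t => t.card = l)
      (s' := fun t => (s ∩ t).powersetCard (l - r))]
  · congr 1
    rw [← Finset.sum_subset (Finset.subset_univ (Finset.univ.filter fun t => t.card = l))]
    · refine Finset.sum_congr rfl fun t _ => ?_
      rw [Finset.sum_const, Finset.card_powersetCard, nsmul_eq_mul]
    · intro t _ ht
      rw [hf t (by simpa using ht), mul_zero]
  · intro u t
    simp only [Finset.mem_filter, Finset.mem_univ, true_and, Finset.mem_powersetCard,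
      Finset.subset_inter_iff]
    constructor
    · rintro ⟨⟨h1, h2⟩, h3, h4⟩
      exact ⟨⟨⟨h1, h3⟩, by omega⟩, by omega⟩
    · rintro ⟨⟨⟨h1, h3⟩, h2⟩, h4⟩
      exact ⟨⟨h1, by omega⟩, h3, by omega⟩

/-- Pulling out C(c,l-k) leaves the alternating sum of row c - (l-k) of Pascal's triangle. As c ≤ l,
the whole row is in range, so the sum vanishes unless the row is trivial. -/
theorem sum_alternating_choose_inversion {l k c : ℕ} (hk : k ≤ l) (hc : c ≤ l) :
    ∑ r ∈ Finset.range (k + 1),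
      (-1 : ℤ) ^ (k - r) * ((l - r).choose (k - r) : ℤ) * (c.choose (l - r) : ℤ)
      = if c = l - k then 1 else 0 := by
  have term : ∀ r ∈ Finset.range (k + 1),
      (-1 : ℤ) ^ (k - r) * ((l - r).choose (k - r) : ℤ) * (c.choose (l - r) : ℤ)
      = (c.choose (l - k) : ℤ) * ((-1) ^ (k - r) * ((c - (l - k)).choose (k - r) : ℤ)) := by
    intro r hr
    have hrk : r ≤ k := by simpa [Nat.lt_succ_iff] using hr
    have h := Nat.choose_mul (n := c) (k := l - r) (s := l - k) (by omega)
    rw [show l - r - (l - k) = k - r by omega,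
      Nat.choose_symm_of_eq_add (show l - r = (l - k) + (k - r) by omega)] at h
    have h' : (c.choose (l - r) : ℤ) * ((l - r).choose (k - r) : ℕ)
      = (c.choose (l - k) : ℕ) * ((c - (l - k)).choose (k - r) : ℕ) := by exact_mod_cast h
    linear_combination (-1 : ℤ) ^ (k - r) * h'
  rw [Finset.sum_congr rfl term, ← Finset.mul_sum]
  have reflect := Finset.sum_range_reflect
    (fun i => (-1 : ℤ) ^ i * ((c - (l - k)).choose i : ℤ)) (k + 1)
  simp only [Nat.add_sub_cancel] at reflect
  rw [reflect]
  rcases lt_or_ge c (l - k) with h | h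
  · rw [Nat.choose_eq_zero_of_lt h, if_neg (by omega)]
    simp
  · have hsub : ∑ i ∈ Finset.range (c - (l - k) + 1), (-1 : ℤ) ^ i * ((c - (l - k)).choose i : ℤ)
        = ∑ i ∈ Finset.range (k + 1), (-1 : ℤ) ^ i * ((c - (l - k)).choose i : ℤ) := by
      refine Finset.sum_subset (Finset.range_mono (by omega)) fun i _ hi => ?_
      rw [Nat.choose_eq_zero_of_lt (by simpa [Nat.lt_succ_iff] using hi)]
      simp
    rw [← hsub, Int.alternating_sum_range_choose]
    split_ifs with h1 h2 h2
    · simp [h2]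
    · omega
    · omega
    · simp

/-- The adjacency operators of the Johnson scheme act by scalars on the harmonic components. -/
theorem sum_filter_card_inter_eq_smul {l j k : ℕ} (hk : k ≤ l) (hj : j ≤ l)
    (hjn : j + l ≤ Fintype.card ι) {f : Finset ι → ℂ} (hf : f ∈ harmonicComponent ι l j)
    {s : Finset ι} (hs : s.card = l) :
    ∑ t ∈ Finset.univ.filter (fun t : Finset ι => t.card = l ∧ (s ∩ t).card = l - k), f t
      = (alphaScheme (Fintype.card ι) l k j : ℂ) * f s := by
  have hfl := harmonicComponent_le_level hj hf
  -- Evaluate `raise ^ r * lower ^ r` both by its kernel and by its eigenvalue, then cancel r!².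
  have hC : ∀ r ∈ Finset.range (k + 1), ∑ t, ((s ∩ t).card.choose (l - r) : ℂ) * f t
      = (((l - j).choose r : ℂ) * ((Fintype.card ι - l - j + r).choose r : ℂ)) * f s := by
    intro r hr
    have hrk : r ≤ k := by simpa [Nat.lt_succ_iff] using hr
    have h1 := raise_pow_lower_pow_apply (hrk.trans hk) hfl hs
    obtain ⟨g, hg, rfl⟩ := hf
    rw [raise_pow_lower_pow_raise_pow (q := Fintype.card ι - l - j) (by omega) hg, Pi.smul_apply,
      smul_eq_mul] at h1
    have h0 : (r.factorial : ℂ) ^ 2 ≠ 0 :=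
      pow_ne_zero _ (Nat.cast_ne_zero.mpr (Nat.factorial_ne_zero r))
    refine mul_left_cancel₀ h0 (h1.symm.trans ?_)
    ring
  have hinv : ∀ t, (if t.card = l ∧ (s ∩ t).card = l - k then f t else 0)
      = ∑ r ∈ Finset.range (k + 1), ((-1 : ℂ) ^ (k - r) * ((l - r).choose (k - r) : ℂ))
        * (((s ∩ t).card.choose (l - r) : ℂ) * f t) := by
    intro t
    by_cases ht : t.card = l
    · have h := congrArg (fun z : ℤ => (z : ℂ) * f t) (sum_alternating_choose_inversion
        (c := (s ∩ t).card) hk ((Finset.card_le_card Finset.inter_subset_left).trans hs.le))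
      simp only [ht, true_and]
      push_cast at h
      rw [ite_mul, one_mul, zero_mul, Finset.sum_mul] at h
      rw [← h]
      exact Finset.sum_congr rfl fun r _ => by ring
    · simp [ht, hfl t ht]
  rw [Finset.sum_filter, Finset.sum_congr rfl fun t _ => hinv t, Finset.sum_comm, alphaScheme,
    Complex.ofReal_sum, Finset.sum_mul]
  refine Finset.sum_congr rfl fun r hr => ?_
  rw [← Finset.mul_sum, hC r hr]
  push_cast
  ring

end BooleanLattice

/-! ### Linear algebra of direct sums. -/

theorem iSupIndep_finrank_iSup {K E κ : Type*} [Field K] [AddCommGroup E] [Module K E]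
    [FiniteDimensional K E] [Fintype κ] [DecidableEq κ] {A : κ → Submodule K E}
    (h : iSupIndep A) :
    Module.finrank K (⨆ i, A i : Submodule K E) = ∑ i, Module.finrank K (A i) := by
  rw [Submodule.iSup_eq_range_dfinsupp_lsum,
    LinearMap.finrank_range_of_inj h.dfinsupp_lsum_injective]
  exact Module.finrank_directSum K (fun i => A i)

open Polynomial in
theorem charpoly_eq_prod_of_isInternal {K E κ : Type*} [Field K] [AddCommGroup E] [Module K E]
    [FiniteDimensional K E] [Fintype κ] [DecidableEq κ] {A : κ → Submodule K E}
    (h : DirectSum.IsInternal A) (T : Module.End K E) (c : κ → K)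
    (hT : ∀ i, ∀ v ∈ A i, T v = c i • v) :
    T.charpoly = ∏ i, (X - C (c i)) ^ Module.finrank K (A i) := by
  let b := h.collectedBasis fun i => Module.finBasis K (A i)
  have hdiag : LinearMap.toMatrix b b T = Matrix.diagonal fun a => c a.1 := by
    ext a a'
    rw [LinearMap.toMatrix_apply, hT a'.1 _ (h.collectedBasis_mem _ a'), map_smul,
      Finsupp.smul_apply, Module.Basis.repr_self, Matrix.diagonal_apply, Finsupp.single_apply]
    by_cases haa : a = a'
    · subst haa; simp
    · simp [haa, Ne.symm haa]
  rw [← LinearMap.charpoly_toMatrix T b, hdiag, Matrix.charpoly_diagonal, Fintype.prod_sigma]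
  simp

/-! ### Transport to qubits. -/

/-- Bit strings correspond to sets of positions. -/
def bitsSupport (n : ℕ) : Bits n ≃ Finset (Fin n) where
  toFun x := {i | x i ≠ 0}
  invFun s i := if i ∈ s then 1 else 0
  left_inv x := by
    ext i
    have := (x i).isLt
    by_cases h : x i = 0
    · simp [h]
    · have : x i = 1 := by omega
      simp [this]
  right_inv s := by ext i; simp

theorem card_bitsSupport {n : ℕ} (x : Bits n) : (bitsSupport n x).card = hammingNorm x := rfl

/-- The distance is the size of the symmetric difference of the supports. At common weight l,
distance 2k therefore means intersection of size l - k. -/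
theorem hammingDist_add_two_mul_card_inter {n : ℕ} (x y : Bits n) :
    hammingDist x y + 2 * (bitsSupport n x ∩ bitsSupport n y).card
      = hammingNorm x + hammingNorm y := by
  have h : hammingDist x y
      = (bitsSupport n x \ bitsSupport n y ∪ bitsSupport n y \ bitsSupport n x).card := by
    rw [hammingDist]
    congr 1
    ext i
    simp only [bitsSupport, Equiv.coe_fn_mk, Finset.mem_filter, Finset.mem_univ, true_and,
      Finset.mem_union, Finset.mem_sdiff]
    have := (x i).isLt
    have := (y i).isLt
    omega
  rw [h, Finset.card_union_of_disjoint disjoint_sdiff_sdiff, ← card_bitsSupport,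
    ← card_bitsSupport, ← Finset.card_sdiff_add_card_inter (bitsSupport n x) (bitsSupport n y),
    ← Finset.card_sdiff_add_card_inter (bitsSupport n y) (bitsSupport n x),
    Finset.inter_comm (bitsSupport n y)]
  ring

/-- Functions on the Boolean lattice as vectors of the qubit space. -/
def toQubit (n : ℕ) : (Finset (Fin n) → ℂ) ≃ₗ[ℂ] QubitSpace n :=
  (LinearEquiv.funCongrLeft ℂ ℂ (bitsSupport n)).trans (WithLp.linearEquiv 2 ℂ (Bits n → ℂ)).symm

theorem toQubit_apply {n : ℕ} (f : Finset (Fin n) → ℂ) (x : Bits n) :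
    toQubit n f x = f (bitsSupport n x) := rfl

theorem inner_toQubit {n : ℕ} (f g : Finset (Fin n) → ℂ) :
    inner ℂ (toQubit n f) (toQubit n g) = star f ⬝ᵥ g := by
  rw [PiLp.inner_apply, dotProduct, ← Equiv.sum_comp (bitsSupport n)]
  simp [toQubit_apply, mul_comm]

theorem mem_weightSpace {n l : ℕ} {v : QubitSpace n} :
    v ∈ weightSpace n l ↔ ∀ x, hammingNorm x ≠ l → v x = 0 := by
  constructor
  · intro hv
    induction hv using Submodule.span_induction with
    | mem v hv =>
      obtain ⟨y, hy, rfl⟩ := hv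
      intro x hx
      have : x ≠ y := by rintro rfl; exact hx hy
      simp [this]
    | zero => simp
    | add v w _ _ hv hw => intro x hx; simp [hv x hx, hw x hx]
    | smul c v _ hv => intro x hx; simp [hv x hx]
  · intro hv
    have : v = ∑ x, v x • EuclideanSpace.single x (1 : ℂ) := by
      ext y
      simp [Finset.sum_apply, Pi.single_apply]
    rw [this]
    refine Submodule.sum_mem _ fun x _ => ?_
    by_cases hx : hammingNorm x = l
    · exact Submodule.smul_mem _ _ (Submodule.subset_span ⟨x, hx, rfl⟩)
    · simp [hv x hx]

theorem map_toQubit_level (n l : ℕ) :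
    (level (Fin n) l).map (toQubit n).toLinearMap = weightSpace n l := by
  ext v
  rw [mem_weightSpace, Submodule.mem_map]
  constructor
  · rintro ⟨f, hf, rfl⟩ x hx
    exact hf _ hx
  · intro hv
    refine ⟨(toQubit n).symm v, fun s hs => ?_, by simp⟩
    have := hv ((bitsSupport n).symm s) (by simpa [← card_bitsSupport] using hs)
    rw [← (toQubit n).apply_symm_apply v, toQubit_apply, Equiv.apply_symm_apply] at this
    exact this

theorem finrank_weightSpace (n l : ℕ) : Module.finrank ℂ (weightSpace n l) = n.choose l := by
  rw [← map_toQubit_level, LinearEquiv.finrank_map_eq, finrank_level, Fintype.card_fin]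

theorem mem_weightSpace_orthogonal {n l : ℕ} {v : QubitSpace n} (hv : v ∈ (weightSpace n l)ᗮ)
    {x : Bits n} (hx : hammingNorm x = l) : v x = 0 := by
  have := (Submodule.mem_orthogonal _ _).mp hv (EuclideanSpace.single x 1)
    (Submodule.subset_span ⟨x, hx, rfl⟩)
  simpa [EuclideanSpace.inner_single_left] using this

theorem rho_apply (p : ℝ) (a b : Fin 2) : rho p a b = 1 / 2 * (if a ≠ b then (p : ℂ) else 1) := by
  have hk : ∀ c, ketPlus c = ((1 / Real.sqrt 2 : ℝ) : ℂ) := by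
    intro c
    fin_cases c <;> simp [ketPlus]
  have h2 : ((1 / Real.sqrt 2 : ℝ) : ℂ) * ((1 / Real.sqrt 2 : ℝ) : ℂ) = 1 / 2 := by
    rw [← Complex.ofReal_mul, div_mul_div_comm, Real.mul_self_sqrt (by norm_num)]
    norm_num
  rw [rho, Matrix.add_apply, Matrix.smul_apply, Matrix.smul_apply, Matrix.smul_apply,
    Matrix.vecMulVec_apply, Pi.star_apply, hk, hk, Complex.star_def, Complex.conj_ofReal, h2,
    Matrix.one_apply]
  by_cases hab : a = b
  · simp [hab]; ring
  · simp [hab, mul_comm]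

theorem tensorPow_rho_apply {n : ℕ} (p : ℝ) (x y : Bits n) :
    tensorPow (rho p) n x y = 1 / 2 ^ n * (p : ℂ) ^ hammingDist x y := by
  simp only [tensorPow, Matrix.of_apply, rho_apply]
  rw [Finset.prod_mul_distrib, Finset.prod_ite, hammingDist]
  simp

theorem rhoL_apply {n l : ℕ} (p : ℝ) (x y : Bits n) :
    rhoL n l p x y = if hammingNorm x = l ∧ hammingNorm y = l
      then 1 / 2 ^ n * (p : ℂ) ^ hammingDist x y else 0 := by
  rw [rhoL, weightProj, Matrix.mul_diagonal, Matrix.diagonal_mul, tensorPow_rho_apply]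
  by_cases hx : hammingNorm x = l <;> by_cases hy : hammingNorm y = l <;> simp [hx, hy]

/-- Two strings of weight l lie at an even distance 2k with k ≤ l, so exactly one `hammingOp` sees
each such entry. -/
theorem rhoL_eq_sum (n l : ℕ) (p : ℝ) : rhoL n l p
    = ∑ k ∈ Finset.range (l + 1), (1 / 2 ^ n * (p : ℂ) ^ (2 * k)) • hammingOp n l k := by
  ext x y
  rw [rhoL_apply, Matrix.sum_apply]
  simp only [Matrix.smul_apply, hammingOp, Matrix.of_apply, smul_eq_mul]
  by_cases h : hammingNorm x = l ∧ hammingNorm y = l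
  · have hd := hammingDist_add_two_mul_card_inter x y
    rw [h.1, h.2] at hd
    have hd' : hammingDist x y = 2 * (l - (bitsSupport n x ∩ bitsSupport n y).card) := by omega
    rw [Finset.sum_eq_single_of_mem (l - (bitsSupport n x ∩ bitsSupport n y).card)
      (Finset.mem_range.mpr (by omega)), if_pos h, if_pos ⟨h.1, h.2, hd'⟩, mul_one, ← hd']
    intro k _ hk
    rw [if_neg (by omega), mul_zero]
  · rw [if_neg h, Finset.sum_eq_zero]
    intro k _
    rw [if_neg (by tauto), mul_zero]

theorem toEuclideanLin_apply_eq_sum {n : ℕ} (M : Matrix (Bits n) (Bits n) ℂ) (v : QubitSpace n)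
    (x : Bits n) : Matrix.toEuclideanLin M v x = ∑ y, M x y * v y := rfl

theorem hammingOp_toQubit {n l j k : ℕ} (hk : k ≤ l) (hj : j ≤ l) (hjn : j + l ≤ n)
    {f : Finset (Fin n) → ℂ} (hf : f ∈ harmonicComponent (Fin n) l j) :
    Matrix.toEuclideanLin (hammingOp n l k) (toQubit n f)
      = (alphaScheme n l k j : ℂ) • toQubit n f := by
  ext x
  rw [toEuclideanLin_apply_eq_sum, PiLp.smul_apply, smul_eq_mul, toQubit_apply]
  by_cases hx : hammingNorm x = l
  · have h := sum_filter_card_inter_eq_smul hk hj (by simpa using hjn) hf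
      (s := bitsSupport n x) hx
    rw [Fintype.card_fin] at h
    rw [← h, Finset.sum_filter, ← Equiv.sum_comp (bitsSupport n)]
    refine Finset.sum_congr rfl fun y _ => ?_
    have hd := hammingDist_add_two_mul_card_inter x y
    simp only [hammingOp, Matrix.of_apply, toQubit_apply, card_bitsSupport, hx, true_and, ite_mul,
      one_mul, zero_mul]
    have hcard : (bitsSupport n x ∩ bitsSupport n y).card ≤ l :=
      (Finset.card_le_card Finset.inter_subset_left).trans hx.le
    refine if_congr (and_congr_right fun hy => ?_) rfl rfl
    omega
  · have h0 : f (bitsSupport n x) = 0 := harmonicComponent_le_level hj hf _ hx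
    rw [h0, mul_zero]
    refine Finset.sum_eq_zero fun y _ => ?_
    simp [hammingOp, hx]

theorem rhoL_weightSpace_orthogonal {n l : ℕ} (p : ℝ) {v : QubitSpace n}
    (hv : v ∈ (weightSpace n l)ᗮ) : Matrix.toEuclideanLin (rhoL n l p) v = 0 := by
  ext x
  rw [toEuclideanLin_apply_eq_sum]
  refine Finset.sum_eq_zero fun y _ => ?_
  rw [rhoL_apply]
  by_cases hy : hammingNorm y = l
  · rw [mem_weightSpace_orthogonal hv hy, mul_zero]
  · simp [hy]

/-! ### Orthogonal decomposition and dimension count. -/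

/-- The `j`-th harmonic component of the weight space. -/
def weightComponent (n l j : ℕ) : Submodule ℂ (QubitSpace n) :=
  (harmonicComponent (Fin n) l j).map (toQubit n).toLinearMap

theorem weightComponent_le {n l j : ℕ} (hj : j ≤ l) : weightComponent n l j ≤ weightSpace n l := by
  rw [← map_toQubit_level]
  exact Submodule.map_mono (harmonicComponent_le_level hj)

theorem weightComponent_isOrtho {n l i j : ℕ} (hij : i < j) (hj : j ≤ l) (hjn : j + l ≤ n) :
    weightComponent n l i ⟂ weightComponent n l j := by
  rw [Submodule.isOrtho_iff_inner_eq]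
  rintro _ ⟨f, hf, rfl⟩ _ ⟨g, hg, rfl⟩
  exact (inner_toQubit f g).trans
    (dotProduct_harmonicComponent_eq_zero hij hj (by simpa using hjn) hf hg)

theorem finrank_weightComponent {n l j : ℕ} (hj : j ≤ l) (hjn : j + l ≤ n) :
    Module.finrank ℂ (weightComponent n l j) = Module.finrank ℂ (harmonicSpace (Fin n) j) := by
  rw [weightComponent, LinearEquiv.finrank_map_eq, finrank_harmonicComponent hj (by simpa using hjn)]

/-- Telescoping: the subtracted dimension is C(n,j-1), and zero at j = 0. -/
theorem sum_choose_sub_finrank_shiftedLevel (n m : ℕ) :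
    ∑ j ∈ Finset.range (m + 1),
      ((n.choose j : ℤ) - Module.finrank ℂ (shiftedLevel (Fin n) 1 j)) = n.choose m := by
  induction m with
  | zero => simp [finrank_shiftedLevel_one_zero]
  | succ m ih => rw [Finset.sum_range_succ, ih, finrank_shiftedLevel_one_succ]; simp

theorem weightComponent_pairwise (n l : ℕ) (hl : l ≤ n) :
    Pairwise fun i j : Fin (min l (n - l) + 1) =>
      weightComponent n l i ⟂ weightComponent n l j := by
  intro i j hij
  rcases lt_or_gt_of_ne hij with h | h
  · exact weightComponent_isOrtho h (by omega) (by omega)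
  · exact (weightComponent_isOrtho h (by omega) (by omega)).symm

theorem iSupIndep_weightComponent (n l : ℕ) (hl : l ≤ n) :
    iSupIndep fun j : Fin (min l (n - l) + 1) => weightComponent n l j :=
  (OrthogonalFamily.of_pairwise (weightComponent_pairwise n l hl)).independent

theorem sum_finrank_harmonicSpace_le (n l : ℕ) (hl : l ≤ n) :
    ∑ j ∈ Finset.range (min l (n - l) + 1), Module.finrank ℂ (harmonicSpace (Fin n) j)
      ≤ n.choose l := by
  rw [← finrank_weightSpace, ← Fin.sum_univ_eq_sum_range]
  rw [Finset.sum_congr rfl fun (j : Fin (min l (n - l) + 1)) _ =>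
    (finrank_weightComponent (n := n) (l := l) (j := j) (by omega) (by omega)).symm]
  rw [← iSupIndep_finrank_iSup (iSupIndep_weightComponent n l hl)]
  exact Submodule.finrank_mono (iSup_le fun j => weightComponent_le (by omega))

theorem choose_min_sub {n l : ℕ} (hl : l ≤ n) : n.choose (min l (n - l)) = n.choose l := by
  rcases min_choice l (n - l) with h | h <;> rw [h]
  exact Nat.choose_symm hl

/-- The termwise lower bounds already sum to C(n,l), which also bounds the total dimension from
above; hence each is an equality. -/
theorem finrank_harmonicSpace {n l j : ℕ} (hl : l ≤ n) (hj : j ≤ min l (n - l)) :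
    (Module.finrank ℂ (harmonicSpace (Fin n) j) : ℤ)
      = n.choose j - Module.finrank ℂ (shiftedLevel (Fin n) 1 j) := by
  have hle : ∀ i ∈ Finset.range (min l (n - l) + 1),
      (n.choose i : ℤ) - Module.finrank ℂ (shiftedLevel (Fin n) 1 i)
        ≤ Module.finrank ℂ (harmonicSpace (Fin n) i) := by
    intro i _
    have := finrank_level_le (ι := Fin n) i
    rw [finrank_level, Fintype.card_fin] at this
    omega
  have hsum := Finset.sum_le_sum hle
  have hub : (∑ i ∈ Finset.range (min l (n - l) + 1),
      (Module.finrank ℂ (harmonicSpace (Fin n) i) : ℤ)) ≤ n.choose l := by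
    exact_mod_cast sum_finrank_harmonicSpace_le n l hl
  have heq := le_antisymm hsum (by
    rw [sum_choose_sub_finrank_shiftedLevel, choose_min_sub hl]; exact hub)
  exact ((Finset.sum_eq_sum_iff_of_le hle).mp heq j (Finset.mem_range.mpr (by omega))).symm

theorem iSup_weightComponent (n l : ℕ) (hl : l ≤ n) :
    ⨆ j : Fin (min l (n - l) + 1), weightComponent n l j = weightSpace n l := by
  refine Submodule.eq_of_le_of_finrank_eq (iSup_le fun j => weightComponent_le (by omega)) ?_
  rw [iSupIndep_finrank_iSup (iSupIndep_weightComponent n l hl), finrank_weightSpace]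
  rw [Finset.sum_congr rfl fun (j : Fin (min l (n - l) + 1)) _ =>
    finrank_weightComponent (n := n) (l := l) (j := j) (by omega) (by omega)]
  rw [Fin.sum_univ_eq_sum_range fun j => Module.finrank ℂ (harmonicSpace (Fin n) j)]
  zify
  rw [Finset.sum_congr rfl fun j hj => finrank_harmonicSpace (n := n) (l := l) (j := j) hl
    (by simpa [Nat.lt_succ_iff] using hj), sum_choose_sub_finrank_shiftedLevel, choose_min_sub hl]

theorem finrank_weightComponent_eq {n l j : ℕ} (hl : l ≤ n) (hj : j ≤ min l (n - l)) :
    (Module.finrank ℂ (weightComponent n l j) : ℝ)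
      = (n.choose j : ℝ) * ((n : ℝ) - 2 * j + 1) / ((n : ℝ) - j + 1) := by
  have h := finrank_harmonicSpace hl hj
  rw [finrank_weightComponent (by omega) (by omega)]
  have hjn : j ≤ n := by omega
  have hpos : (n : ℝ) - j + 1 ≠ 0 := by
    have : (j : ℝ) ≤ n := by exact_mod_cast hjn
    linarith
  have h' : (Module.finrank ℂ (harmonicSpace (Fin n) j) : ℝ)
      = n.choose j - (Module.finrank ℂ (shiftedLevel (Fin n) 1 j) : ℝ) := by exact_mod_cast h
  rw [h', eq_div_iff hpos]
  cases j with
  | zero => simp [finrank_shiftedLevel_one_zero]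
  | succ j =>
    rw [finrank_shiftedLevel_one_succ, Fintype.card_fin]
    -- This ratio of neighbouring binomials turns C(n,j+1) - C(n,j) into the stated quotient.
    have hc : (n.choose (j + 1) : ℝ) * (j + 1) = n.choose j * (n - j) := by
      rw [← Nat.cast_sub (by omega : j ≤ n)]
      exact_mod_cast Nat.choose_succ_right_eq n j
    push_cast
    linear_combination hc

theorem rhoL_weightComponent {n l j : ℕ} (hj : j ≤ l) (hjn : j + l ≤ n) (p : ℝ)
    {v : QubitSpace n} (hv : v ∈ weightComponent n l j) :
    Matrix.toEuclideanLin (rhoL n l p) v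
      = (lam n l p (fun k => alphaScheme n l k j) : ℂ) • v := by
  obtain ⟨f, hf, rfl⟩ := hv
  rw [rhoL_eq_sum, map_sum, LinearMap.sum_apply, lam, Complex.ofReal_mul, Complex.ofReal_sum,
    Finset.mul_sum, Finset.sum_smul]
  refine Finset.sum_congr rfl fun k hk => ?_
  have h := hammingOp_toQubit (k := k) (by simpa [Nat.lt_succ_iff] using hk) hj hjn hf
  rw [map_smul, LinearMap.smul_apply]
  refine (congrArg _ h).trans ?_
  rw [smul_smul]
  push_cast
  rw [mul_assoc]

/-! ### Characteristic polynomial and conclusion. -/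

theorem charpoly_toEuclideanLin {n : ℕ} (M : Matrix (Bits n) (Bits n) ℂ) :
    (Matrix.toEuclideanLin M).charpoly = M.charpoly := by
  rw [show Matrix.toEuclideanLin M = _ from DFunLike.congr_fun (Matrix.toLpLin_eq_toLin 2 2) M,
    Matrix.charpoly_toLin]

open Polynomial in
theorem charpoly_rhoL (n l : ℕ) (hl : l ≤ n) (p : ℝ) :
    (rhoL n l p).charpoly = X ^ (2 ^ n - n.choose l)
      * ∏ j : Fin (min l (n - l) + 1),
        (X - C (lam n l p (fun k => alphaScheme n l k j) : ℂ))
          ^ Module.finrank ℂ (weightComponent n l j) := by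
  -- The index `none` holds the orthogonal complement, where `rhoL` is zero; it supplies the power
  -- of X.
  let A : Option (Fin (min l (n - l) + 1)) → Submodule ℂ (QubitSpace n) := fun o =>
    o.elim (weightSpace n l)ᗮ fun j => weightComponent n l j
  have hA : Pairwise fun i j => A i ⟂ A j := by
    have hW : ∀ j : Fin (min l (n - l) + 1), weightComponent n l j ⟂ (weightSpace n l)ᗮ := fun j =>
      (Submodule.isOrtho_orthogonal_right (weightSpace n l)).mono_left
        (weightComponent_le (by omega))
    rintro (_ | i) (_ | j) hij
    · exact absurd rfl hij
    · exact (hW j).symm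
    · exact hW i
    · exact weightComponent_pairwise n l hl (fun h => hij (congrArg some h))
  have hint : DirectSum.IsInternal A := by
    rw [(OrthogonalFamily.of_pairwise hA).isInternal_iff, iSup_option]
    change ((weightSpace n l)ᗮ ⊔ ⨆ j : Fin (min l (n - l) + 1), weightComponent n l j)ᗮ = ⊥
    rw [iSup_weightComponent n l hl, sup_comm, Submodule.sup_orthogonal_of_hasOrthogonalProjection,
      Submodule.top_orthogonal_eq_bot]
  have hfin : Module.finrank ℂ (weightSpace n l)ᗮ = 2 ^ n - n.choose l := by
    have h := (weightSpace n l).finrank_add_finrank_orthogonal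
    rw [finrank_weightSpace, finrank_euclideanSpace] at h
    simp at h
    omega
  have key := charpoly_eq_prod_of_isInternal hint (Matrix.toEuclideanLin (rhoL n l p))
    (fun o => o.elim 0 fun j => (lam n l p (fun k => alphaScheme n l k j) : ℂ)) (by
      rintro (_ | j) v hv
      · simpa using rhoL_weightSpace_orthogonal p hv
      · exact rhoL_weightComponent (by omega) (by omega) p hv)
  rw [← charpoly_toEuclideanLin, key, Fintype.prod_option, ← hfin, Option.elim_none, C_0, sub_zero]
  rfl
theorem mainTheorem1 (n l : ℕ) (hl : l ≤ n) :
    ∃ (α : ℕ → Fin (min l (n - l) + 1) → ℝ)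
      (B : Fin (min l (n - l) + 1) → Submodule ℂ (QubitSpace n)),
      -- an orthogonal decomposition of the weight space into pieces of dimension `f_j`
      (Pairwise fun i j => B i ⟂ B j) ∧
      (⨆ j, B j) = weightSpace n l ∧
      (∀ j, (Module.finrank ℂ (B j) : ℝ)
        = (n.choose j : ℝ) * ((n : ℝ) - 2 * (j : ℕ) + 1) / ((n : ℝ) - (j : ℕ) + 1)) ∧
      -- on the `j`-th piece every `A_k` acts as the scalar `α_k(j)`
      (∀ k ≤ l, ∀ j, ∀ v ∈ B j,
        Matrix.toEuclideanLin (hammingOp n l k) v = (α k j : ℂ) • v) ∧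
      -- the closed forms of `α_k(j)`
      (∀ k ≤ l, ∀ j, α k j = alphaYoung n l k j ∧ α k j = alphaScheme n l k j ∧
        α k j = dualHahn n l k (j : ℕ)) ∧
      -- the eigenvalues of `P_l ρ^{⊗ n} P_l`, with multiplicities
      ∀ p : ℝ,
        (∀ j, ∀ v ∈ B j, Matrix.toEuclideanLin (rhoL n l p) v
          = (lam n l p (fun k => α k j) : ℂ) • v) ∧
        (rhoL n l p).charpoly = Polynomial.X ^ (2 ^ n - n.choose l)
          * ∏ j, (Polynomial.X - Polynomial.C (lam n l p (fun k => α k j) : ℂ))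
              ^ Module.finrank ℂ (B j) := by
  -- `alphaScheme` is the form that the sl₂ computation yields directly.
  refine ⟨fun k j => alphaScheme n l k j, fun j => weightComponent n l j,
    weightComponent_pairwise n l hl, iSup_weightComponent n l hl,
    fun j => finrank_weightComponent_eq hl (by omega), ?_, ?_, fun p => ⟨?_, ?_⟩⟩
  · rintro k hk j _ ⟨f, hf, rfl⟩
    exact hammingOp_toQubit hk (by omega) (by omega) hf
  · intro k hk j
    have hjl : (j : ℕ) ≤ l := by omega
    have hjn : (j : ℕ) ≤ n - l := by omega
    exact ⟨(alphaScheme_eq_eberlein k hjl).trans (alphaYoung_eq_eberlein hjn).symm, rfl,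
      (dualHahn_eq_alphaScheme hk hl hjl hjn).symm⟩
  · intro j v hv
    exact rhoL_weightComponent (by omega) (by omega) p hv
  · exact charpoly_rhoL n l hl p
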